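/- **Proposition 2.4.** Let $M$ be a $C^\infty$ smooth paracompact Hausdorff manifold without boundary, of dimension $n$, and let $1\le r\le\infty$. *Groups.* Let $\mathrm{Diff}^r(M)$ be the group of $C^r$ diffeomorphisms of $M$. A $C^r$ isotopy in a subgroup $G\le \mathrm{Diff}^r(M)$ is a family $(f_t)_{t\in\mathbb R}$ in $G$ with $f_0=\mathrm{id}$ such that $(t,x)\mapsto f_t(x)$ is of class $C^r$ on $\mathbb R\times M$; it is compactly supported if there is a compact set $K\subset M$ such that every $f_t$ is the identity outside $K$. Let $\mathfrak G^r(M)$ (resp. $\mathfrak G^r_c(M)$) be the class of subgroups $G\le\mathrm{Diff}^r(M)$ that are isotopically connected (resp. isotopically connected through compactly supported isotopies), i.e. such that every $g\in G$ equals $f_1$ for some isotopy (resp. some compactly supported isotopy) $(f_t)$ in $G$. Then $\mathfrak G^r_c(M)\subset\mathfrak G^r(M)$. *Foliations.* A subset $L\subset M$ with a $C^r$ manifold structure for which the inclusion $L\to M$ is an immersion is weakly imbedded if, for every locally connected space $N$, every continuous map $f:N\to M$ with $f(N)\subset L$ is continuous as a map to $L$; such a structure on $L$ is unique. A (singular)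 foliation of class $C^r$ of $M$ is a partition $\mathcal F$ of $M$ into connected weakly imbedded submanifolds of class $C^r$, called leaves, such that for every $x\in M$, if $k$ is the dimension of the leaf through $x$, there is a $C^r$ chart $(U,\phi)$ of $M$ at $x$ with $\phi(x)=0$ and $\phi(U)=V\times W$, where $V\subset\mathbb R^k$ and $W\subset\mathbb R^{n-k}$ are open, such that $\phi(L\cap U)=V\times\{w\in W:\phi^{-1}(0,w)\in L\}$ for every $L\in\mathcal F$. Let $\mathfrak F^r(M)$ be the class of these foliations. *The maps.* For $\mathcal F\in\mathfrak F^r(M)$ let $\mathrm{Diff}^r(M,\mathcal F)$ be the group of those $f\in\mathrm{Diff}^r(M)$ with $f(L)=L$ for every leaf $L\in\mathcal F$, and let $\alpha_M(\mathcal F)=G_{\mathcal F}:=\mathrm{Diff}^r_c(M,\mathcal F)_0\in\mathfrak G^r_c(M)$ be its subgroup of the elements that can be joined to the identity through a compactly supported $C^r$ isotopy in $\mathrm{Diff}^r(M,\mathcal F)$. A $C^r$-arrow is a $C^r$ map $\phi$ of an open subset of $\mathbb R\times M$ into $M$ such that each $\phi_t=\phi(t,\cdot)$ is a $C^r$ diffeomorphism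 of an open (possibly empty) subset of $M$ onto an open subset of $M$, $\phi_0=\mathrm{id}$ on its domain, and $\mathrm{dom}(\phi_t)\subset\mathrm{dom}(\phi_s)$ whenever $0\le s<t$. For a set $\mathcal A$ of arrows, the accessible sets of $\mathcal A$ are the orbits of the finite compositions of the local diffeomorphisms $\phi_t$ and $\phi_t^{-1}$ ($\phi\in\mathcal A$, $t\in\mathbb R$) and of the identity. For $G\in\mathfrak G^r(M)$ let $\beta_M(G)=\mathcal F_G$ be the partition of $M$ into the accessible sets of the set $\mathcal A_G$ of all arrows that are restrictions of isotopies in $G$ to open subsets of $\mathbb R\times M$. Then $\beta_M(\alpha_M(\mathcal F))=\mathcal F$ for every $\mathcal F\in\mathfrak F^r(M)$, that is, $\beta_M\circ\alpha_M=\mathrm{id}_{\mathfrak F^r(M)}$. In particular, $\alpha_M:\mathfrak F^r(M)\to\mathfrak G^r_c(M)$, $\mathcal F\mapsto G_{\mathcal F}$, is an injection, which identifies the $C^r$ foliations of $M$ with a subclass of the isotopically connected groups of $C^r$ diffeomorphisms of $M$. -/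

import Mathlib

open Set Function
open scoped Manifold ContDiff

namespace StefanFoliation

universe u

/-! ### The group of diffeomorphisms of class `C^r` -/

/-- `Diff^r(M)` for a manifold `M` of dimension `n`. -/
abbrev CrDiffeo (n : ℕ) (r : ℕ∞ω) (M : Type u) [TopologicalSpace M]
    [ChartedSpace (EuclideanSpace ℝ (Fin n)) M] : Type u :=
  M ≃ₘ^r⟮𝓡 n, 𝓡 n⟯ M

section Manifold

variable {n : ℕ} {r : ℕ∞ω} {M : Type u} [TopologicalSpace M]
  [ChartedSpace (EuclideanSpace ℝ (Fin n)) M]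

/-- The group structure on `Diff^r(M)`; the product is composition, `(f * g) x = f (g x)`. -/
noncomputable instance instGroupCrDiffeo : Group (CrDiffeo n r M) where
  mul f g := g.trans f
  one := Diffeomorph.refl (𝓡 n) M r
  inv f := f.symm
  mul_assoc _ _ _ := rfl
  one_mul _ := rfl
  mul_one _ := rfl
  inv_mul_cancel f := Diffeomorph.ext fun x => f.symm_apply_apply x

@[simp] theorem mul_apply (f g : CrDiffeo n r M) (x : M) : (f * g) x = f (g x) := rfl

@[simp] theorem one_apply (x : M) : (1 : CrDiffeo n r M) x = x := rfl

@[simp] theorem inv_apply_self (f : CrDiffeo n r M) (x : M) : f⁻¹ (f x) = x :=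
  f.symm_apply_apply x

@[simp] theorem apply_inv_self (f : CrDiffeo n r M) (x : M) : f (f⁻¹ x) = x :=
  f.apply_symm_apply x

/-! ### Isotopies and isotopically connected groups -/

/-- `(f_t)_{t ∈ ℝ}` is a `C^r` isotopy in the group `G`: the map `(t, x) ↦ f_t x` is of class `C^r`
on `ℝ × M`, `f_0 = id`, and `f_t ∈ G` for all `t`. -/
structure IsIsotopyIn (G : Subgroup (CrDiffeo n r M)) (f : ℝ → CrDiffeo n r M) : Prop where
  contMDiff : ContMDiff (𝓘(ℝ, ℝ).prod (𝓡 n)) (𝓡 n) r (fun p : ℝ × M => f p.1 p.2)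
  zero : f 0 = 1
  mem : ∀ t, f t ∈ G

/-- The isotopy is the identity outside one compact set. -/
def IsCompactlySupported (f : ℝ → CrDiffeo n r M) : Prop :=
  ∃ K : Set M, IsCompact K ∧ ∀ t, ∀ x ∉ K, f t x = x

/-- `G` is isotopically connected. -/
def IsotopicallyConnected (G : Subgroup (CrDiffeo n r M)) : Prop :=
  ∀ g ∈ G, ∃ f : ℝ → CrDiffeo n r M, IsIsotopyIn G f ∧ f 1 = g

/-- `G` is isotopically connected through compactly supported isotopies. -/
def CompactlyIsotopicallyConnected (G : Subgroup (CrDiffeo n r M)) : Prop :=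
  ∀ g ∈ G, ∃ f : ℝ → CrDiffeo n r M, IsIsotopyIn G f ∧ IsCompactlySupported f ∧ f 1 = g

variable (n r M) in
/-- The class `𝔊^r(M)` of isotopically connected groups of `C^r` diffeomorphisms. -/
abbrev IsotopicGroups : Type u :=
  {G : Subgroup (CrDiffeo n r M) // IsotopicallyConnected G}

variable (n r M) in
/-- The class `𝔊^r_c(M)` of groups of `C^r` diffeomorphisms that are isotopically connected through
compactly supported isotopies. -/
abbrev CompactIsotopicGroups : Type u :=
  {G : Subgroup (CrDiffeo n r M) // CompactlyIsotopicallyConnected G}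

/-- The inclusion of `𝔊^r_c(M)` in `𝔊^r(M)`. -/
def CompactIsotopicGroups.toIsotopicGroups (G : CompactIsotopicGroups n r M) :
    IsotopicGroups n r M :=
  ⟨G.1, fun g hg => by
    obtain ⟨f, hf, -, h1⟩ := G.2 g hg
    exact ⟨f, hf, h1⟩⟩

/-- For a group `H` of diffeomorphisms, the subgroup `H_{c,0}` of those elements that can be joined
to the identity through a compactly supported `C^r` isotopy in `H`. -/
def compactIdentityComponent (H : Subgroup (CrDiffeo n r M)) : Subgroup (CrDiffeo n r M) where
  carrier := {g | ∃ f : ℝ → CrDiffeo n r M, IsIsotopyIn H f ∧ IsCompactlySupported f ∧ f 1 = g}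
  mul_mem' := by
    rintro _ _ ⟨f, hf, ⟨K, hK, hfK⟩, rfl⟩ ⟨g, hg, ⟨L, hL, hgL⟩, rfl⟩
    refine ⟨fun t => f t * g t, ⟨?_, ?_, fun t => H.mul_mem (hf.mem t) (hg.mem t)⟩,
      ⟨K ∪ L, hK.union hL, fun t x hx => ?_⟩, rfl⟩
    · exact hf.contMDiff.comp (contMDiff_fst.prodMk hg.contMDiff)
    · simp [hf.zero, hg.zero]
    · rw [mul_apply, hgL t x fun h => hx (Or.inr h), hfK t x fun h => hx (Or.inl h)]
  one_mem' := ⟨fun _ => 1, ⟨contMDiff_snd, rfl, fun _ => H.one_mem⟩,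
    ⟨∅, isCompact_empty, fun _ _ _ => rfl⟩, rfl⟩
  inv_mem' := by
    rintro _ ⟨f, hf, ⟨K, hK, hfK⟩, rfl⟩
    refine ⟨fun t => f (1 - t) * (f 1)⁻¹,
      ⟨?_, ?_, fun t => H.mul_mem (hf.mem _) (H.inv_mem (hf.mem 1))⟩,
      ⟨K, hK, fun t x hx => ?_⟩, ?_⟩
    · have h1 : ContMDiff 𝓘(ℝ, ℝ) 𝓘(ℝ, ℝ) r (fun t : ℝ => 1 - t) :=
        (contDiff_const.sub contDiff_id).contMDiff
      exact hf.contMDiff.comp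
        ((h1.comp contMDiff_fst).prodMk ((f 1)⁻¹.contMDiff.comp contMDiff_snd))
    · simp
    · have h : (f 1)⁻¹ x = x := by
        conv_lhs => rw [← hfK 1 x hx]
        exact inv_apply_self _ _
      rw [mul_apply, h, hfK _ x hx]
    · simp [hf.zero]

/-- `H_{c,0}` is isotopically connected through compactly supported isotopies. -/
theorem compactlyIsotopicallyConnected_compactIdentityComponent
    (H : Subgroup (CrDiffeo n r M)) :
    CompactlyIsotopicallyConnected (compactIdentityComponent H) := by
  rintro _ ⟨f, hf, ⟨K, hK, hfK⟩, rfl⟩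
  refine ⟨f, ⟨hf.contMDiff, hf.zero, fun t => ?_⟩, ⟨K, hK, hfK⟩, rfl⟩
  refine ⟨fun s => f (s * t), ⟨?_, ?_, fun s => hf.mem _⟩, ⟨K, hK, fun s => hfK _⟩, ?_⟩
  · have h1 : ContMDiff 𝓘(ℝ, ℝ) 𝓘(ℝ, ℝ) r (fun s : ℝ => s * t) :=
      (contDiff_id.mul contDiff_const).contMDiff
    exact hf.contMDiff.comp ((h1.comp contMDiff_fst).prodMk contMDiff_snd)
  · simp [hf.zero]
  · simp

/-! ### Foliations -/

variable (n r) in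
/-- `L` is a connected weakly imbedded `k`-dimensional submanifold of class `C^r` of `M`. The
differentiable structure on `L` is given by a `k`-dimensional `C^r` manifold `P` and a bijection
`i` of `P` onto `L`. As a map to `M`, `i` is an immersion; and a map `f` from a locally connected
space to `L` which is continuous as a map to `M` is continuous for the topology of `P`. -/
def IsWeaklyImbedded (k : ℕ) (L : Set M) : Prop :=
  ∃ (P : Type u) (_ : TopologicalSpace P) (_ : ChartedSpace (EuclideanSpace ℝ (Fin k)) P)
    (_ : IsManifold (𝓡 k) r P) (_ : ConnectedSpace P) (i : P → M),
    Injective i ∧ range i = L ∧ Manifold.IsImmersion (𝓡 k) (𝓡 n) r i ∧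
    ∀ (N : Type u) [TopologicalSpace N] [LocallyConnectedSpace N] (f : N → P),
      Continuous (i ∘ f) → Continuous f

variable (n r) in
/-- The partition `leaves` of `M` has at `x` a distinguished chart for a `k`-dimensional leaf: a
`C^r` chart `φ` of `M` on a neighbourhood `U` of `x`, with `φ x = 0` and `φ U = V × W`, such that
`φ (L ∩ U) = V × {w ∈ W | φ⁻¹ (0, w) ∈ L}` for every leaf `L`. -/
def HasDistinguishedChart (leaves : Set (Set M)) (k : ℕ) (x : M) : Prop :=
  ∃ (φ : OpenPartialHomeomorph M
        (EuclideanSpace ℝ (Fin k) × EuclideanSpace ℝ (Fin (n - k))))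
    (V : Set (EuclideanSpace ℝ (Fin k))) (W : Set (EuclideanSpace ℝ (Fin (n - k)))),
    ContMDiffOn (𝓡 n) 𝓘(ℝ, EuclideanSpace ℝ (Fin k) × EuclideanSpace ℝ (Fin (n - k))) r
      φ φ.source ∧
    ContMDiffOn 𝓘(ℝ, EuclideanSpace ℝ (Fin k) × EuclideanSpace ℝ (Fin (n - k))) (𝓡 n) r
      φ.symm φ.target ∧
    x ∈ φ.source ∧ φ x = 0 ∧ IsOpen V ∧ IsOpen W ∧ φ.target = V ×ˢ W ∧
    ∀ L ∈ leaves, φ '' (L ∩ φ.source) = V ×ˢ {w ∈ W | φ.symm (0, w) ∈ L}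

variable (n r M) in
/-- The class `𝔉^r(M)` of (singular) foliations of class `C^r` of `M`: partitions of `M` into
connected weakly imbedded submanifolds with distinguished charts at all points. -/
@[ext]
structure Foliation where
  leaves : Set (Set M)
  isPartition : Setoid.IsPartition leaves
  exists_dim : ∀ L ∈ leaves, ∃ k : ℕ, IsWeaklyImbedded n r k L ∧
    ∀ x ∈ L, HasDistinguishedChart n r leaves k x

/-- The group `Diff^r(M, F)` of leaf preserving `C^r` diffeomorphisms. -/
def Foliation.leafPreserving (F : Foliation n r M) : Subgroup (CrDiffeo n r M) where
  carrier := {f | ∀ L ∈ F.leaves, f '' L = L}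
  mul_mem' := by
    intro f g hf hg L hL
    have h : ((f * g : CrDiffeo n r M) : M → M) = f ∘ g := rfl
    rw [h, image_comp, hg L hL, hf L hL]
  one_mem' := fun L _ => image_id L
  inv_mem' := by
    intro f hf L hL
    conv_lhs => rw [← hf L hL]
    rw [← image_comp]
    have h : ((f⁻¹ : CrDiffeo n r M) : M → M) ∘ f = id := funext fun x => inv_apply_self f x
    rw [h, image_id]

/-- The map `α_M : 𝔉^r(M) → 𝔊^r_c(M)` which sends `F` to `G_F = Diff^r_c(M, F)_0`. -/
def alpha (F : Foliation n r M) : CompactIsotopicGroups n r M :=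
  ⟨compactIdentityComponent F.leafPreserving,
    compactlyIsotopicallyConnected_compactIdentityComponent _⟩

/-! ### Arrows and accessible sets -/

variable (n r M) in
/-- A `C^r`-arrow: a `C^r` map from an open subset `dom` of `ℝ × M` to `M` (the values of `toFun`
outside `dom` are irrelevant). -/
structure Arrow where
  dom : Set (ℝ × M)
  toFun : ℝ × M → M
  isOpen_dom : IsOpen dom
  contMDiffOn : ContMDiffOn (𝓘(ℝ, ℝ).prod (𝓡 n)) (𝓡 n) r toFun dom
  /-- Each `φ_t` is a `C^r` diffeomorphism of an open set onto an open set. -/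
  localDiffeo : ∀ t : ℝ, ∃ ψ : OpenPartialHomeomorph M M,
    ψ.source = {x | (t, x) ∈ dom} ∧ EqOn ψ (fun x => toFun (t, x)) ψ.source ∧
    ContMDiffOn (𝓡 n) (𝓡 n) r ψ ψ.source ∧ ContMDiffOn (𝓡 n) (𝓡 n) r ψ.symm ψ.target
  zero : ∀ x, (0, x) ∈ dom → toFun (0, x) = x
  anti : ∀ s t : ℝ, 0 ≤ s → s < t → {x | (t, x) ∈ dom} ⊆ {x | (s, x) ∈ dom}

/-- `𝒜*`: the local diffeomorphisms `φ_t` with `φ ∈ 𝒜` and `t ∈ ℝ`. -/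
def arrowStar (A : Set (Arrow n r M)) : Set (OpenPartialHomeomorph M M) :=
  {ψ | ∃ φ ∈ A, ∃ t : ℝ, ψ.source = {x | (t, x) ∈ φ.dom} ∧
    EqOn ψ (fun x => φ.toFun (t, x)) ψ.source}

/-- The finite compositions of elements of `𝒜*` and of `(𝒜*)⁻¹`, and the identity. -/
inductive ArrowHat (A : Set (Arrow n r M)) : OpenPartialHomeomorph M M → Prop
  | refl : ArrowHat A (OpenPartialHomeomorph.refl M)
  | step {ψ χ : OpenPartialHomeomorph M M} :
      ArrowHat A ψ → χ ∈ arrowStar A → ArrowHat A (ψ.trans χ)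
  | step_inv {ψ χ : OpenPartialHomeomorph M M} :
      ArrowHat A ψ → χ ∈ arrowStar A → ArrowHat A (ψ.trans χ.symm)

/-- The accessible set of `𝒜` through `x`: the orbit of `x` under these compositions. -/
def accessibleSet (A : Set (Arrow n r M)) (x : M) : Set M :=
  {y | ∃ ψ : OpenPartialHomeomorph M M, ArrowHat A ψ ∧ x ∈ ψ.source ∧ ψ x = y}

/-- `𝒜_G`: the arrows which are restrictions of isotopies in `G` to open subsets of `ℝ × M`. -/
def isotopyArrows (G : Subgroup (CrDiffeo n r M)) : Set (Arrow n r M) :=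
  {φ | ∃ f : ℝ → CrDiffeo n r M, IsIsotopyIn G f ∧
    EqOn φ.toFun (fun p => f p.1 p.2) φ.dom}

/-- The map `β_M` which sends `G ∈ 𝔊^r(M)` to `F_G`, the partition of `M` into the accessible sets
of `𝒜_G`. The differentiable structure of a weakly imbedded submanifold is unique, so a foliation
is given by its set of leaves. -/
def beta (G : IsotopicGroups n r M) : Set (Set M) :=
  range (accessibleSet (isotopyArrows G.1))

end Manifold

end StefanFoliation

/-!
In an isotopically connected group `G`, the accessible sets of the isotopies in `G` are the orbits
of `G`, so the claim is that the orbits of `G_F` are the leaves of `F`. Since `G_F` preserves the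
leaves, it is enough to show that every orbit of `G_F` in a leaf `L` is open in the topology of
`L`, as `L` is connected. In a distinguished chart centred at `x ∈ L`, compactly supported
isotopies which move points in the direction of the plaques preserve the leaves and carry `x` to
all nearby points of its plaque. Because `L` is weakly imbedded, the parametrization of this
plaque lifts to a continuous map into `L`. The lift is of class `C^r`, since `L` is immersed, and
the first component of the chart is a left inverse of it; as `L` and the plaque have the same
dimension, the lift is open at `x` by the inverse function theorem.
-/

open Filter Metric
open scoped Topology NNReal

namespace StefanFoliation

universe u

section Translation

/-- `Φ` is an isotopy of the vector space `E` through `C^r` diffeomorphisms which are the identity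
outside `K`. Every `Φ t` is bundled as a homeomorphism, so that its inverse is at hand. -/
structure IsIsotopySupportedIn {E : Type*} [NormedAddCommGroup E] [NormedSpace ℝ E] (r : ℕ∞ω)
    (K : Set E) (Φ : ℝ → E ≃ₜ E) : Prop where
  contDiff : ContDiff ℝ r (fun p : ℝ × E => Φ p.1 p.2)
  contDiff_symm : ∀ t, ContDiff ℝ r (Φ t).symm
  zero : Φ 0 = Homeomorph.refl E
  eq_self : ∀ t, ∀ z ∉ K, Φ t z = z

theorem exists_homeomorph_eq_add_of_lipschitzWith {𝕜 E : Type*} [NontriviallyNormedField 𝕜]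
    [NormedAddCommGroup E] [NormedSpace 𝕜 E] [CompleteSpace E] {r : ℕ∞ω} (hr : r ≠ 0) {h : E → E}
    (hh : ContDiff 𝕜 r h) {c : ℝ≥0} (hc : c < 1) (hL : LipschitzWith c h) :
    ∃ Φ : E ≃ₜ E, (∀ z, Φ z = z + h z) ∧ ContDiff 𝕜 r Φ.symm := by
  have approx : ApproximatesLinearOn (fun z => z + h z)
      (ContinuousLinearEquiv.refl 𝕜 E : E →L[𝕜] E) univ c := fun x _ y _ => by
    simpa [add_sub_add_comm] using hL.norm_sub_le x y
  have lt_inv : Subsingleton E ∨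
      c < ‖((ContinuousLinearEquiv.refl 𝕜 E).symm : E →L[𝕜] E)‖₊⁻¹ := by
    refine (subsingleton_or_nontrivial E).imp_right fun (_ : Nontrivial E) => ?_
    simpa [ContinuousLinearMap.nnnorm_id] using hc
  have isUnit_fderiv (z : E) : IsUnit (1 + fderiv 𝕜 h z) := by
    have : ‖-fderiv 𝕜 h z‖ < 1 := by
      rw [norm_neg]
      exact (norm_fderiv_le_of_lipschitz 𝕜 hL).trans_lt (by exact_mod_cast hc)
    simpa using isUnit_one_sub_of_norm_lt_one this
  refine ⟨approx.toHomeomorph _ lt_inv, fun z => rfl, ?_⟩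
  exact Homeomorph.contDiff_symm (f₀' := fun z => .ofUnit (isUnit_fderiv z).unit) _
    (fun z => (hasFDerivAt_id z).add (hh.differentiable hr z).hasFDerivAt) (contDiff_id.add hh)

variable {E : Type*} [NormedAddCommGroup E] [NormedSpace ℝ E]

theorem exists_isIsotopySupportedIn_add_smul [CompleteSpace E] {r : ℕ∞} (hr : r ≠ 0) {K : Set E}
    {b : E → ℝ} (hb : ContDiff ℝ r b) (hbK : ∀ z ∉ K, b z = 0) {C : ℝ≥0} (hC : LipschitzWith C b)
    {u : E} (hu : C * ‖u‖₊ < 1) :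
    ∃ Φ : ℝ → E ≃ₜ E, IsIsotopySupportedIn r K Φ ∧
      ∀ t z, Φ t z = z + (Real.smoothTransition t * b z) • u := by
  have hh : ContDiff ℝ r (fun p : ℝ × E => (Real.smoothTransition p.1 * b p.2) • u) :=
    ((Real.smoothTransition.contDiff.comp contDiff_fst).mul (hb.comp contDiff_snd)).smul
      contDiff_const
  have lipschitz (t : ℝ) :
      LipschitzWith (C * ‖u‖₊) (fun z => (Real.smoothTransition t * b z) • u) := by
    refine LipschitzWith.of_dist_le_mul fun x y => ?_
    calc dist ((Real.smoothTransition t * b x) • u) ((Real.smoothTransition t * b y) • u)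
        = Real.smoothTransition t * dist (b x) (b y) * ‖u‖ := by
          rw [dist_eq_norm, ← sub_smul, ← mul_sub, norm_smul, norm_mul, dist_eq_norm,
            Real.norm_of_nonneg (Real.smoothTransition.nonneg t)]
      _ ≤ 1 * (C * dist x y) * ‖u‖ := by
          gcongr
          exacts [Real.smoothTransition.le_one t, hC.dist_le_mul x y]
      _ = (C * ‖u‖₊ : ℝ≥0) * dist x y := by push_cast; ring
  choose Φ hΦ hΦs using fun t => exists_homeomorph_eq_add_of_lipschitzWith (mod_cast hr)
    (hh.comp (contDiff_const.prodMk contDiff_id)) hu (lipschitz t)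
  refine ⟨Φ, ⟨?_, hΦs, ?_, fun t z hz => ?_⟩, hΦ⟩
  · simp only [hΦ]
    exact contDiff_snd.add hh
  · ext z
    simp [hΦ, Real.smoothTransition.zero]
  · simp [hΦ, hbK z hz]

theorem exists_isIsotopySupportedIn_translation [FiniteDimensional ℝ E] {r : ℕ∞} (hr : r ≠ 0)
    {x : E} {T : Set E} (hT : T ∈ 𝓝 x) :
    ∃ K ⊆ T, IsCompact K ∧ ∀ᶠ u in 𝓝 (0 : E), ∃ Φ : ℝ → E ≃ₜ E, IsIsotopySupportedIn r K Φ ∧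
      (∀ t z, ∃ a : ℝ, Φ t z = z + a • u) ∧ Φ 1 x = x + u := by
  have : ProperSpace E := FiniteDimensional.proper ℝ E
  obtain ⟨ε, hε, hεT⟩ := nhds_basis_closedBall.mem_iff.1 hT
  let b : ContDiffBump x := ⟨ε / 2, ε, half_pos hε, half_lt_self hε⟩
  have b_eq_zero : ∀ z ∉ closedBall x ε, b z = 0 := fun z hz =>
    b.zero_of_le_dist (not_le.1 hz).le
  obtain ⟨C, hC⟩ := (b.contDiff (n := r)).lipschitzWith_of_hasCompactSupport b.hasCompactSupport
    (mod_cast hr)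
  have small : ∀ᶠ u in 𝓝 (0 : E), C * ‖u‖₊ < 1 :=
    ((continuous_const.mul continuous_nnnorm).tendsto' 0 0 (by simp)).eventually_lt_const one_pos
  refine ⟨closedBall x ε, hεT, isCompact_closedBall x ε, small.mono fun u hu => ?_⟩
  obtain ⟨Φ, hΦ, h⟩ := exists_isIsotopySupportedIn_add_smul hr b.contDiff b_eq_zero hC hu
  refine ⟨Φ, hΦ, fun t z => ⟨_, h t z⟩, ?_⟩
  rw [h, b.one_of_mem_closedBall (mem_closedBall_self b.rIn_pos.le), Real.smoothTransition.one,
    one_mul, one_smul]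

end Translation

section ChartExtend

open Classical in
/-- The map `f`, read in the chart `φ` and extended by the identity outside the domain of `φ`. -/
noncomputable def chartExtend {M E : Type*} [TopologicalSpace M] [TopologicalSpace E]
    (φ : OpenPartialHomeomorph M E) (f : E → E) (x : M) : M :=
  if x ∈ φ.source then φ.symm (f (φ x)) else x

section Topology

variable {M E : Type*} [TopologicalSpace M] [TopologicalSpace E] {φ : OpenPartialHomeomorph M E}
  {x : M} {f g : E → E} {K : Set E}

theorem chartExtend_of_mem (hx : x ∈ φ.source) (f : E → E) :
    chartExtend φ f x = φ.symm (f (φ x)) :=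
  if_pos hx

theorem chartExtend_of_notMem (hx : x ∉ φ.source) (f : E → E) : chartExtend φ f x = x :=
  if_neg hx

theorem chartExtend_id (φ : OpenPartialHomeomorph M E) : chartExtend φ id = id := by
  ext x
  by_cases hx : x ∈ φ.source
  · rw [chartExtend_of_mem hx, id, φ.left_inv hx, id]
  · exact chartExtend_of_notMem hx id

theorem chartExtend_eq_self (hf : ∀ z ∉ K, f z = z) (hx : x ∉ φ.symm '' K) :
    chartExtend φ f x = x := by
  by_cases h : x ∈ φ.source
  · rw [chartExtend_of_mem h, hf _ fun hK => hx ⟨_, hK, φ.left_inv h⟩, φ.left_inv h]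
  · exact chartExtend_of_notMem h f

theorem leftInverse_chartExtend (hf : MapsTo f φ.target φ.target)
    (hgf : LeftInvOn g f φ.target) : LeftInverse (chartExtend φ g) (chartExtend φ f) := by
  intro x
  by_cases h : x ∈ φ.source
  · have hfx := hf (φ.map_source h)
    rw [chartExtend_of_mem h, chartExtend_of_mem (φ.map_target hfx), φ.right_inv hfx,
      hgf (φ.map_source h), φ.left_inv h]
  · rw [chartExtend_of_notMem h, chartExtend_of_notMem h]

end Topology

theorem contMDiff_chartExtend {𝕜 E E' H M P : Type*} [NontriviallyNormedField 𝕜]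
    [NormedAddCommGroup E] [NormedSpace 𝕜 E] [NormedAddCommGroup E'] [NormedSpace 𝕜 E']
    [TopologicalSpace H] {I : ModelWithCorners 𝕜 E' H} [TopologicalSpace M] [T2Space M]
    [ChartedSpace H M] [NormedAddCommGroup P] [NormedSpace 𝕜 P] {r : ℕ∞ω}
    {φ : OpenPartialHomeomorph M E} (hφ : ContMDiffOn I 𝓘(𝕜, E) r φ φ.source)
    (hφs : ContMDiffOn 𝓘(𝕜, E) I r φ.symm φ.target) {K : Set E} (hK : IsCompact K)
    (hKφ : K ⊆ φ.target) {F : P → E → E} (hF : ContDiff 𝕜 r (fun p : P × E => F p.1 p.2))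
    (hFφ : ∀ t, MapsTo (F t) φ.target φ.target) (hFK : ∀ t, ∀ z ∉ K, F t z = z) :
    ContMDiff (𝓘(𝕜, P).prod I) I r (fun p : P × M => chartExtend φ (F p.1) p.2) := by
  intro p
  by_cases hp : p.2 ∈ φ.source
  · have in_chart : ContMDiffOn (𝓘(𝕜, P).prod I) I r
        (fun p : P × M => φ.symm (F p.1 (φ p.2))) (Prod.snd ⁻¹' φ.source) := by
      refine hφs.comp ?_ fun q hq => hFφ _ (φ.map_source hq)
      exact hF.contMDiff.comp_contMDiffOn
        (contMDiffOn_fst.prodMk_space (hφ.comp contMDiffOn_snd fun q hq => hq))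
    have source_mem : Prod.snd ⁻¹' φ.source ∈ 𝓝 p :=
      (φ.open_source.preimage continuous_snd).mem_nhds hp
    refine (in_chart.contMDiffAt source_mem).congr_of_eventuallyEq ?_
    filter_upwards [source_mem] with q hq using chartExtend_of_mem hq _
  · have isClosed : IsClosed (φ.symm '' K) :=
      (hK.image_of_continuousOn (φ.continuousOn_symm.mono hKφ)).isClosed
    have notMem : p.2 ∉ φ.symm '' K := by
      rintro ⟨z, hz, h⟩
      exact hp (h ▸ φ.map_target (hKφ hz))
    refine contMDiffAt_snd.congr_of_eventuallyEq ?_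
    filter_upwards [(isClosed.isOpen_compl.preimage continuous_snd).mem_nhds notMem] with q hq
    exact chartExtend_eq_self (hFK _) hq

theorem mapsTo_of_injective_of_eq_self {α : Type*} {f : α → α} (hf : Injective f) {K T : Set α}
    (hKT : K ⊆ T) (hfK : ∀ z ∉ K, f z = z) : MapsTo f T T := by
  intro z hz
  by_cases h : f z ∈ K
  · exact hKT h
  · rwa [hf (hfK _ h)]

variable {E : Type*} [NormedAddCommGroup E] [NormedSpace ℝ E] {r : ℕ∞ω} {K : Set E}
  {Φ : ℝ → E ≃ₜ E}

namespace IsIsotopySupportedIn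

theorem symm_eq_self (hΦ : IsIsotopySupportedIn r K Φ) (t : ℝ) {z : E} (hz : z ∉ K) :
    (Φ t).symm z = z := by
  rw [(Φ t).symm_apply_eq, hΦ.eq_self t z hz]

theorem mapsTo (hΦ : IsIsotopySupportedIn r K Φ) {T : Set E} (hKT : K ⊆ T) (t : ℝ) :
    MapsTo (Φ t) T T :=
  mapsTo_of_injective_of_eq_self (Φ t).injective hKT (hΦ.eq_self t)

theorem mapsTo_symm (hΦ : IsIsotopySupportedIn r K Φ) {T : Set E} (hKT : K ⊆ T) (t : ℝ) :
    MapsTo (Φ t).symm T T :=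
  mapsTo_of_injective_of_eq_self (Φ t).symm.injective hKT fun _ => hΦ.symm_eq_self t

variable {n : ℕ} {M : Type u} [TopologicalSpace M] [T2Space M]
  [ChartedSpace (EuclideanSpace ℝ (Fin n)) M] {φ : OpenPartialHomeomorph M E}

theorem exists_isotopy_chartExtend (hΦ : IsIsotopySupportedIn r K Φ)
    (hφ : ContMDiffOn (𝓡 n) 𝓘(ℝ, E) r φ φ.source)
    (hφs : ContMDiffOn 𝓘(ℝ, E) (𝓡 n) r φ.symm φ.target) (hK : IsCompact K)
    (hKφ : K ⊆ φ.target) :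
    ∃ f : ℝ → CrDiffeo n r M, IsIsotopyIn ⊤ f ∧ IsCompactlySupported f ∧
      ∀ t, ⇑(f t) = chartExtend φ (Φ t) := by
  have contMDiff : ContMDiff (𝓘(ℝ, ℝ).prod (𝓡 n)) (𝓡 n) r
      (fun p : ℝ × M => chartExtend φ (Φ p.1) p.2) :=
    contMDiff_chartExtend hφ hφs hK hKφ hΦ.contDiff (hΦ.mapsTo hKφ) hΦ.eq_self
  have contMDiff_symm (t : ℝ) : ContMDiff (𝓡 n) (𝓡 n) r (chartExtend φ (Φ t).symm) :=
    (contMDiff_chartExtend (P := ℝ) (F := fun _ => (Φ t).symm) hφ hφs hK hKφ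
      ((hΦ.contDiff_symm t).comp contDiff_snd) (fun _ => hΦ.mapsTo_symm hKφ t)
      fun _ _ => hΦ.symm_eq_self t).comp (contMDiff_const (c := (0 : ℝ)).prodMk contMDiff_id)
  let f (t : ℝ) : CrDiffeo n r M :=
    { toFun := chartExtend φ (Φ t)
      invFun := chartExtend φ (Φ t).symm
      left_inv := leftInverse_chartExtend (hΦ.mapsTo hKφ t) fun z _ => (Φ t).symm_apply_apply z
      right_inv :=
        leftInverse_chartExtend (hΦ.mapsTo_symm hKφ t) fun z _ => (Φ t).apply_symm_apply z
      contMDiff_toFun := contMDiff.comp (contMDiff_const.prodMk contMDiff_id)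
      contMDiff_invFun := contMDiff_symm t }
  have zero : f 0 = 1 := Diffeomorph.ext fun x => by
    change chartExtend φ (Φ 0) x = x
    rw [hΦ.zero]
    exact congrFun (chartExtend_id φ) x
  exact ⟨f, ⟨contMDiff, zero, fun _ => trivial⟩,
    ⟨φ.symm '' K, hK.image_of_continuousOn (φ.continuousOn_symm.mono hKφ),
      fun t _ hx => chartExtend_eq_self (hΦ.eq_self t) hx⟩, fun _ => rfl⟩

end IsIsotopySupportedIn

end ChartExtend

section Orbits

variable {n : ℕ} {r : ℕ∞ω} {M : Type u} [TopologicalSpace M]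
  [ChartedSpace (EuclideanSpace ℝ (Fin n)) M] {G : Subgroup (CrDiffeo n r M)}

/-- The action of `Diff^r(M)` on `M` by evaluation. -/
noncomputable instance : MulAction (CrDiffeo n r M) M where
  smul f x := f x
  one_smul _ := rfl
  mul_smul _ _ _ := rfl

theorem mem_orbit_subgroup_iff {x y : M} : y ∈ MulAction.orbit G x ↔ ∃ g ∈ G, g x = y :=
  ⟨fun ⟨g, h⟩ => ⟨g, g.2, h⟩, fun ⟨g, hg, h⟩ => ⟨⟨g, hg⟩, h⟩⟩

/-- The isotopy `f`, as an arrow defined on all of `ℝ × M`. -/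
noncomputable def IsIsotopyIn.arrow {f : ℝ → CrDiffeo n r M} (hf : IsIsotopyIn G f) :
    Arrow n r M where
  dom := univ
  toFun p := f p.1 p.2
  isOpen_dom := isOpen_univ
  contMDiffOn := hf.contMDiff.contMDiffOn
  localDiffeo t := ⟨(f t).toHomeomorph.toOpenPartialHomeomorph, by simp, fun _ _ => rfl,
    (f t).contMDiff.contMDiffOn, (f t).symm.contMDiff.contMDiffOn⟩
  zero x _ := by rw [hf.zero, one_apply]
  anti _ _ _ _ := Subset.rfl

theorem apply_mem_orbit_of_mem_arrowStar {χ : OpenPartialHomeomorph M M}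
    (hχ : χ ∈ arrowStar (isotopyArrows G)) {x : M} (hx : x ∈ χ.source) :
    χ x ∈ MulAction.orbit G x := by
  obtain ⟨a, ⟨f, hf, hfa⟩, t, hs, hχ⟩ := hχ
  have hxt : (t, x) ∈ a.dom := hs.subset hx
  exact mem_orbit_subgroup_iff.2 ⟨f t, hf.mem t, ((hχ hx).trans (hfa hxt)).symm⟩

theorem ArrowHat.apply_mem_orbit {ψ : OpenPartialHomeomorph M M}
    (hψ : ArrowHat (isotopyArrows G) ψ) {x : M} (hx : x ∈ ψ.source) :
    ψ x ∈ MulAction.orbit G x := by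
  induction hψ with
  | refl => exact MulAction.mem_orbit_self x
  | @step ψ χ _ hχ ih =>
    rw [OpenPartialHomeomorph.trans_source] at hx
    rw [← MulAction.orbit_eq_iff.2 (ih hx.1)]
    exact apply_mem_orbit_of_mem_arrowStar hχ hx.2
  | @step_inv ψ χ _ hχ ih =>
    rw [OpenPartialHomeomorph.trans_source] at hx
    rw [← MulAction.orbit_eq_iff.2 (ih hx.1), MulAction.mem_orbit_symm]
    have := apply_mem_orbit_of_mem_arrowStar hχ (χ.map_target hx.2)
    rwa [χ.right_inv hx.2] at this

theorem accessibleSet_isotopyArrows (hG : IsotopicallyConnected G) (x : M) :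
    accessibleSet (isotopyArrows G) x = MulAction.orbit G x := by
  refine Subset.antisymm ?_ fun y hy => ?_
  · rintro _ ⟨ψ, hψ, hx, rfl⟩
    exact hψ.apply_mem_orbit hx
  · obtain ⟨_, hg, rfl⟩ := mem_orbit_subgroup_iff.1 hy
    obtain ⟨f, hf, rfl⟩ := hG _ hg
    exact ⟨_, ArrowHat.refl.step (χ := (f 1).toHomeomorph.toOpenPartialHomeomorph)
      ⟨hf.arrow, ⟨f, hf, fun _ _ => rfl⟩, 1, rfl, fun _ _ => rfl⟩, ⟨trivial, trivial⟩, rfl⟩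

end Orbits

section DistinguishedChart

variable {n : ℕ} {M : Type u} [TopologicalSpace M] [ChartedSpace (EuclideanSpace ℝ (Fin n)) M]
  {E₁ E₂ : Type*} [NormedAddCommGroup E₁] [NormedSpace ℝ E₁] [NormedAddCommGroup E₂]
  [NormedSpace ℝ E₂]

variable (n) in
/-- `φ` is a distinguished chart of class `C^r` centred at `x` for the partition `leaves` of `M`,
with image `V × W`: the predicate behind `HasDistinguishedChart`, with `ℝᵏ × ℝⁿ⁻ᵏ` replaced by
an arbitrary product of normed spaces. -/
structure IsDistinguishedChartAt (r : ℕ∞ω) (leaves : Set (Set M))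
    (φ : OpenPartialHomeomorph M (E₁ × E₂)) (V : Set E₁) (W : Set E₂) (x : M) : Prop where
  contMDiffOn : ContMDiffOn (𝓡 n) 𝓘(ℝ, E₁ × E₂) r φ φ.source
  contMDiffOn_symm : ContMDiffOn 𝓘(ℝ, E₁ × E₂) (𝓡 n) r φ.symm φ.target
  mem_source : x ∈ φ.source
  apply_eq_zero : φ x = 0
  isOpen_left : IsOpen V
  target_eq : φ.target = V ×ˢ W
  image_inter_source : ∀ L ∈ leaves, φ '' (L ∩ φ.source) = V ×ˢ {w ∈ W | φ.symm (0, w) ∈ L}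

theorem HasDistinguishedChart.exists_isDistinguishedChartAt {r : ℕ∞ω} {leaves : Set (Set M)}
    {k : ℕ} {x : M} (h : HasDistinguishedChart n r leaves k x) :
    ∃ (φ : OpenPartialHomeomorph M (EuclideanSpace ℝ (Fin k) × EuclideanSpace ℝ (Fin (n - k))))
      (V : Set (EuclideanSpace ℝ (Fin k))) (W : Set (EuclideanSpace ℝ (Fin (n - k)))),
      IsDistinguishedChartAt n r leaves φ V W x := by
  obtain ⟨φ, V, W, hφ, hφs, hx, hx0, hV, -, hVW, hL⟩ := h
  exact ⟨φ, V, W, hφ, hφs, hx, hx0, hV, hVW, hL⟩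

namespace IsDistinguishedChartAt

variable {r : ℕ∞ω} {leaves : Set (Set M)} {φ : OpenPartialHomeomorph M (E₁ × E₂)} {V : Set E₁}
  {W : Set E₂} {x : M}

theorem zero_mem_target (h : IsDistinguishedChartAt n r leaves φ V W x) : 0 ∈ φ.target :=
  h.apply_eq_zero ▸ φ.map_source h.mem_source

theorem symm_zero (h : IsDistinguishedChartAt n r leaves φ V W x) : φ.symm 0 = x := by
  rw [← h.apply_eq_zero, φ.left_inv h.mem_source]

theorem mk_zero_mem_target (h : IsDistinguishedChartAt n r leaves φ V W x) {v : E₁} (hv : v ∈ V) :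
    (v, (0 : E₂)) ∈ φ.target :=
  h.target_eq ▸ ⟨hv, (h.target_eq ▸ h.zero_mem_target).2⟩

theorem mem_nhds_zero (h : IsDistinguishedChartAt n r leaves φ V W x) : V ∈ 𝓝 (0 : E₁) :=
  h.isOpen_left.mem_nhds (h.target_eq ▸ h.zero_mem_target).1

theorem symm_mem_iff (h : IsDistinguishedChartAt n r leaves φ V W x) {L : Set M} (hL : L ∈ leaves)
    {z : E₁ × E₂} (hz : z ∈ φ.target) : φ.symm z ∈ L ↔ φ.symm (0, z.2) ∈ L := by
  have target_inter := h.image_inter_source L hL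
  rw [inter_comm, φ.image_source_inter_eq'] at target_inter
  have hVW : z ∈ V ×ˢ W := h.target_eq ▸ hz
  calc φ.symm z ∈ L ↔ z ∈ φ.target ∩ φ.symm ⁻¹' L := (and_iff_right hz).symm
    _ ↔ z ∈ V ×ˢ {w ∈ W | φ.symm (0, w) ∈ L} := by rw [target_inter]
    _ ↔ φ.symm (0, z.2) ∈ L := (and_iff_right hVW.1).trans (and_iff_right hVW.2)

theorem symm_mk_zero_mem (h : IsDistinguishedChartAt n r leaves φ V W x) {L : Set M}
    (hL : L ∈ leaves) (hx : x ∈ L) {v : E₁} (hv : v ∈ V) : φ.symm (v, 0) ∈ L := by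
  rw [h.symm_mem_iff hL (h.mk_zero_mem_target hv)]
  exact h.symm_zero ▸ hx

theorem mapsTo_chartExtend (h : IsDistinguishedChartAt n r leaves φ V W x) {L : Set M}
    (hL : L ∈ leaves) {f : E₁ × E₂ → E₁ × E₂} (hf : MapsTo f φ.target φ.target)
    (hf₂ : ∀ z, (f z).2 = z.2) : MapsTo (chartExtend φ f) L L := by
  intro y hy
  by_cases hyφ : y ∈ φ.source
  · have hz := φ.map_source hyφ
    rwa [chartExtend_of_mem hyφ, h.symm_mem_iff hL (hf hz), hf₂, ← h.symm_mem_iff hL hz,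
      φ.left_inv hyφ]
  · rwa [chartExtend_of_notMem hyφ]

end IsDistinguishedChartAt

theorem Foliation.mem_leafPreserving_of_mapsTo {r : ℕ∞ω} (F : Foliation n r M)
    {f : CrDiffeo n r M} (hf : ∀ L ∈ F.leaves, MapsTo f L L) : f ∈ F.leafPreserving := by
  refine fun L hL => (hf L hL).image_subset.antisymm fun y hy => ?_
  obtain ⟨L', ⟨hL', hyL'⟩, -⟩ := F.isPartition.2 (f⁻¹ y)
  have hy' : y ∈ L' := apply_inv_self f y ▸ hf L' hL' hyL'
  rw [Setoid.eq_of_mem_eqv_class F.isPartition.2 hL hy hL' hy']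
  exact ⟨f⁻¹ y, hyL', apply_inv_self f y⟩

theorem IsDistinguishedChartAt.eventually_symm_mem_orbit [T2Space M] [FiniteDimensional ℝ E₁]
    [FiniteDimensional ℝ E₂] {r : ℕ∞} (hr : r ≠ 0) {F : Foliation n r M}
    {φ : OpenPartialHomeomorph M (E₁ × E₂)} {V : Set E₁} {W : Set E₂} {x : M}
    (h : IsDistinguishedChartAt n r F.leaves φ V W x) :
    ∀ᶠ v in 𝓝 (0 : E₁), φ.symm (v, 0) ∈ MulAction.orbit (alpha F).1 x := by
  obtain ⟨K, hKφ, hK, translation⟩ :=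
    exists_isIsotopySupportedIn_translation hr (φ.open_target.mem_nhds h.zero_mem_target)
  have tendsto : Tendsto (fun v : E₁ => (v, (0 : E₂))) (𝓝 0) (𝓝 0) :=
    Continuous.tendsto' (by fun_prop) _ _ rfl
  filter_upwards [tendsto.eventually translation] with v ⟨Φ, hΦ, hΦv, hΦ1⟩
  obtain ⟨f, hf, f_supp, hfΦ⟩ :=
    hΦ.exists_isotopy_chartExtend h.contMDiffOn h.contMDiffOn_symm hK hKφ
  have snd_eq (t : ℝ) (z : E₁ × E₂) : (Φ t z).2 = z.2 := by
    obtain ⟨a, ha⟩ := hΦv t z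
    simp [ha]
  have f_mem (t : ℝ) : f t ∈ F.leafPreserving :=
    F.mem_leafPreserving_of_mapsTo fun L hL =>
      hfΦ t ▸ h.mapsTo_chartExtend hL (hΦ.mapsTo hKφ t) (snd_eq t)
  have apply_one : f 1 x = φ.symm (v, 0) := by
    rw [hfΦ, chartExtend_of_mem h.mem_source, h.apply_eq_zero, hΦ1, zero_add]
  exact mem_orbit_subgroup_iff.2
    ⟨f 1, ⟨f, ⟨hf.contMDiff, hf.zero, f_mem⟩, f_supp, rfl⟩, apply_one⟩

end DistinguishedChart

section Leaf

theorem map_nhds_eq_of_comp_eventuallyEq_id {𝕜 E H P : Type*} [RCLike 𝕜] [NormedAddCommGroup E]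
    [NormedSpace 𝕜 E] [FiniteDimensional 𝕜 E] [TopologicalSpace H] {I : ModelWithCorners 𝕜 E H}
    [I.Boundaryless] [TopologicalSpace P] [ChartedSpace H P] {r : ℕ∞ω} (hr : r ≠ 0) {j : E → P}
    {h : P → E} {v : E} (hj : ContMDiffAt 𝓘(𝕜, E) I r j v)
    (hh : MDifferentiableAt I 𝓘(𝕜, E) h (j v)) (hhj : h ∘ j =ᶠ[𝓝 v] id) :
    map j (𝓝 v) = 𝓝 (j v) := by
  have : CompleteSpace E := FiniteDimensional.complete 𝕜 E
  set e := extChartAt I (j v)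
  have j_source : ∀ᶠ w in 𝓝 v, j w ∈ e.source :=
    hj.continuousAt (extChartAt_source_mem_nhds (j v))
  have contDiffAt_ej : ContDiffAt 𝕜 r (e ∘ j) v := (contMDiffAt_iff_target.1 hj).2.contDiffAt
  have differentiableAt_he : DifferentiableAt 𝕜 (h ∘ e.symm) (e (j v)) := by
    have := hh.differentiableWithinAt_writtenInExtChartAt
    rwa [I.range_eq_univ, differentiableWithinAt_univ] at this
  have comp_eq_id : (h ∘ e.symm) ∘ e ∘ j =ᶠ[𝓝 v] id := by
    filter_upwards [j_source, hhj] with w hw hhw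
    rwa [comp_apply, comp_apply, comp_apply, e.left_inv hw]
  have fderiv_comp_eq_id :
      (fderiv 𝕜 (h ∘ e.symm) (e (j v))).comp (fderiv 𝕜 (e ∘ j) v) = .id 𝕜 E :=
    (differentiableAt_he.hasFDerivAt.comp v
      (contDiffAt_ej.differentiableAt hr).hasFDerivAt).unique
        ((hasFDerivAt_id v).congr_of_eventuallyEq comp_eq_id)
  have injective : Injective (fderiv 𝕜 (e ∘ j) v) :=
    LeftInverse.injective fun w => DFunLike.congr_fun fderiv_comp_eq_id w
  have range_eq_top : (fderiv 𝕜 (e ∘ j) v).range = ⊤ :=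
    LinearMap.range_eq_top.2 (LinearMap.injective_iff_surjective.1 injective)
  calc map j (𝓝 v) = map (e.symm ∘ e ∘ j) (𝓝 v) :=
        map_congr (j_source.mono fun w hw => (e.left_inv hw).symm)
    _ = map e.symm (map (e ∘ j) (𝓝 v)) := map_map.symm
    _ = map e.symm (𝓝 (e (j v))) := by
        rw [(contDiffAt_ej.hasStrictFDerivAt hr).map_nhds_eq_of_surj range_eq_top, comp_apply]
    _ = 𝓝 (j v) := by
        rw [← nhdsWithin_univ, ← I.range_eq_univ, map_extChartAt_symm_nhdsWithin_range]

/-- `i` has the lifting property of weak imbeddings, as in the definition of `IsWeaklyImbedded`: a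
map from a locally connected space to the source of `i` is continuous if its composition with `i`
is. -/
def IsWeakImbedding {P : Type u} {M : Type*} [TopologicalSpace P] [TopologicalSpace M]
    (i : P → M) : Prop :=
  ∀ (N : Type u) [TopologicalSpace N] [LocallyConnectedSpace N] (f : N → P),
    Continuous (i ∘ f) → Continuous f

theorem IsWeakImbedding.continuousOn {P : Type u} {M : Type*} [TopologicalSpace P]
    [TopologicalSpace M] {i : P → M} (hi : IsWeakImbedding i) {X : Type} [TopologicalSpace X]
    [LocallyConnectedSpace X] {V : Set X} (hV : IsOpen V) {j : X → P}
    (hij : ContinuousOn (i ∘ j) V) : ContinuousOn j V := by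
  have : LocallyConnectedSpace V := hV.locallyConnectedSpace
  have : LocallyConnectedSpace (ULift.{u} V) := Homeomorph.ulift.locallyConnectedSpace
  rw [continuousOn_iff_continuous_domRestrict] at hij ⊢
  have lift_continuous : Continuous fun v : ULift.{u} V => j v.down :=
    hi _ _ (hij.comp continuous_uliftDown)
  exact lift_continuous.comp continuous_uliftUp

variable {n k : ℕ} {M : Type*} [TopologicalSpace M] [ChartedSpace (EuclideanSpace ℝ (Fin n)) M]
  {E₂ : Type*} [NormedAddCommGroup E₂] [NormedSpace ℝ E₂] {r : ℕ∞ω} {leaves : Set (Set M)}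
  {φ : OpenPartialHomeomorph M (EuclideanSpace ℝ (Fin k) × E₂)}
  {V : Set (EuclideanSpace ℝ (Fin k))} {W : Set E₂} {P : Type u} [TopologicalSpace P] {i : P → M}

namespace IsDistinguishedChartAt

theorem exists_lift {x : M} (h : IsDistinguishedChartAt n r leaves φ V W x)
    (hi : IsWeakImbedding i) (hL : range i ∈ leaves) (hx : x ∈ range i) :
    ∃ j : EuclideanSpace ℝ (Fin k) → P,
      ContinuousOn j V ∧ ∀ v ∈ V, i (j v) = φ.symm (v, 0) := by
  have : Nonempty P := range_nonempty_iff_nonempty.1 ⟨x, hx⟩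
  let j (v : EuclideanSpace ℝ (Fin k)) : P := invFun i (φ.symm (v, 0))
  have i_j : ∀ v ∈ V, i (j v) = φ.symm (v, 0) := fun v hv =>
    invFun_eq (h.symm_mk_zero_mem hL hx hv)
  refine ⟨j, hi.continuousOn h.isOpen_left ?_, i_j⟩
  refine ContinuousOn.congr ?_ i_j
  exact φ.continuousOn_symm.comp (by fun_prop) fun v hv => h.mk_zero_mem_target hv

theorem map_nhds_eq [ChartedSpace (EuclideanSpace ℝ (Fin k)) P] (hr : r ≠ 0) {p : P}
    (h : IsDistinguishedChartAt n r leaves φ V W (i p)) (hi : IsWeakImbedding i)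
    (hinj : Injective i) (himm : Manifold.IsImmersionAt (𝓡 k) (𝓡 n) r i p)
    (hL : range i ∈ leaves) : map i (𝓝 p) = map (fun v => φ.symm (v, 0)) (𝓝 0) := by
  obtain ⟨j, j_cont, i_j⟩ := h.exists_lift hi hL (mem_range_self p)
  have i_j_eventually : i ∘ j =ᶠ[𝓝 0] fun v => φ.symm (v, 0) :=
    eventually_of_mem h.mem_nhds_zero i_j
  have j_zero : j 0 = p := hinj ((i_j_eventually.self_of_nhds).trans h.symm_zero)
  subst j_zero
  have contMDiffAt_plaque : ContMDiffAt (𝓡 k) (𝓡 n) r (fun v => φ.symm (v, 0)) 0 :=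
    (h.contMDiffOn_symm.contMDiffAt (φ.open_target.mem_nhds h.zero_mem_target)).comp
      (0 : EuclideanSpace ℝ (Fin k)) (contDiff_prodMk_left (0 : E₂)).contMDiff.contMDiffAt
  have contMDiffAt_j : ContMDiffAt (𝓡 k) (𝓡 k) r j 0 :=
    (ContMDiffAt.iff_comp_isImmersionAt himm).2 ⟨j_cont.continuousAt h.mem_nhds_zero,
      contMDiffAt_plaque.congr_of_eventuallyEq i_j_eventually⟩
  have mdifferentiableAt_fst : MDifferentiableAt (𝓡 k) (𝓡 k) (fun q => (φ (i q)).1) (j 0) := by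
    have φ_at : ContMDiffAt (𝓡 n) 𝓘(ℝ, EuclideanSpace ℝ (Fin k) × E₂) r φ (i (j 0)) :=
      h.contMDiffOn.contMDiffAt (φ.open_source.mem_nhds h.mem_source)
    exact (contDiff_fst.contMDiff.contMDiffAt.comp _
      (φ_at.comp _ himm.contMDiffAt)).mdifferentiableAt hr
  have fst_j : (fun q => (φ (i q)).1) ∘ j =ᶠ[𝓝 0] id := by
    filter_upwards [h.mem_nhds_zero] with v hv
    rw [comp_apply, i_j v hv, φ.right_inv (h.mk_zero_mem_target hv), id]
  rw [← map_nhds_eq_of_comp_eventuallyEq_id hr contMDiffAt_j mdifferentiableAt_fst fst_j,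
    Filter.map_map, map_congr i_j_eventually]

end IsDistinguishedChartAt

end Leaf

section Foliation

variable {n : ℕ} {M : Type u} [TopologicalSpace M] [ChartedSpace (EuclideanSpace ℝ (Fin n)) M]

theorem alpha_le_leafPreserving {r : ℕ∞ω} (F : Foliation n r M) :
    (alpha F).1 ≤ F.leafPreserving := by
  rintro _ ⟨f, hf, -, rfl⟩
  exact hf.mem 1

variable [T2Space M] {r : ℕ∞} {L : Set M} {x : M}

theorem Foliation.subset_orbit_alpha (hr : r ≠ 0) (F : Foliation n r M) (hL : L ∈ F.leaves)
    (hx : x ∈ L) : L ⊆ MulAction.orbit (alpha F).1 x := by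
  obtain ⟨k, ⟨P, _, _, _, _, i, hinj, rfl, himm, hi⟩, charts⟩ := F.exists_dim L hL
  let SameOrbit (p q : P) : Prop := i q ∈ MulAction.orbit (alpha F).1 (i p)
  have : Std.Symm SameOrbit := ⟨fun _ _ => MulAction.mem_orbit_symm.1⟩
  have trans : IsTrans P SameOrbit :=
    ⟨fun _ _ _ hpq hqs => (MulAction.orbit_eq_iff.2 hpq).subset hqs⟩
  have locally_same (p : P) : ∀ᶠ q in 𝓝 p, SameOrbit p q := by
    obtain ⟨φ, V, W, h⟩ := (charts (i p) (mem_range_self p)).exists_isDistinguishedChartAt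
    have map_eq := h.map_nhds_eq (mod_cast hr) hi hinj (himm.isImmersionAt p) hL
    rw [← eventually_map (m := i) (P := (· ∈ MulAction.orbit (alpha F).1 (i p))), map_eq]
    exact h.eventually_symm_mem_orbit hr
  obtain ⟨p, rfl⟩ := hx
  rintro _ ⟨q, rfl⟩
  exact PreconnectedSpace.induction₂ SameOrbit locally_same trans p q

theorem Foliation.orbit_alpha (hr : r ≠ 0) (F : Foliation n r M) (hL : L ∈ F.leaves)
    (hx : x ∈ L) : MulAction.orbit (alpha F).1 x = L := by
  refine Subset.antisymm (fun y hy => ?_) (F.subset_orbit_alpha hr hL hx)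
  obtain ⟨g, hg, rfl⟩ := mem_orbit_subgroup_iff.1 hy
  exact alpha_le_leafPreserving F hg L hL ▸ mem_image_of_mem g hx

theorem beta_alpha (hr : r ≠ 0) (F : Foliation n r M) :
    beta (alpha F).toIsotopicGroups = F.leaves := by
  have accessibleSet_eq {L : Set M} (hL : L ∈ F.leaves) {x : M} (hx : x ∈ L) :
      accessibleSet (isotopyArrows (alpha F).toIsotopicGroups.1) x = L :=
    (accessibleSet_isotopyArrows (alpha F).toIsotopicGroups.2 x).trans (F.orbit_alpha hr hL hx)
  ext L
  constructor
  · rintro ⟨x, rfl⟩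
    obtain ⟨L, ⟨hL, hx⟩, -⟩ := F.isPartition.2 x
    exact (accessibleSet_eq hL hx).symm ▸ hL
  · intro hL
    obtain ⟨x, hx⟩ := Setoid.nonempty_of_mem_partition F.isPartition hL
    exact ⟨x, accessibleSet_eq hL hx⟩

end Foliation

end StefanFoliation

theorem proposition2p4_general {n : ℕ} {M : Type*} [TopologicalSpace M] [T2Space M]
    [ChartedSpace (EuclideanSpace ℝ (Fin n)) M] (r : ℕ∞) (hr : 1 ≤ r) :
    (∀ F : StefanFoliation.Foliation n r M,
      StefanFoliation.beta (StefanFoliation.alpha F).toIsotopicGroups = F.leaves) ∧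
    Injective (StefanFoliation.alpha : StefanFoliation.Foliation n r M →
      StefanFoliation.CompactIsotopicGroups n r M) := by
  have beta_alpha := StefanFoliation.beta_alpha (n := n) (M := M) (one_pos.trans_le hr).ne'
  refine ⟨beta_alpha, fun F F' h => ?_⟩
  ext1
  rw [← beta_alpha F, h, beta_alpha F']

theorem proposition2p4 {n : ℕ} {M : Type*} [TopologicalSpace M] [T2Space M] [ParacompactSpace M]
    [ChartedSpace (EuclideanSpace ℝ (Fin n)) M] [IsManifold (𝓡 n) ∞ M]
    (r : ℕ∞) (hr : 1 ≤ r) :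
    (∀ F : StefanFoliation.Foliation n r M,
      StefanFoliation.beta (StefanFoliation.alpha F).toIsotopicGroups = F.leaves) ∧
    Injective (StefanFoliation.alpha : StefanFoliation.Foliation n r M →
      StefanFoliation.CompactIsotopicGroups n r M) := by
  exact proposition2p4_general r hr
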